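/- Let $G=(V,E)$ be a finite, simple, connected, undirected graph on $n$ vertices. For $w\in\mathbb{R}^E$ let $\mathcal{L}(w)=\sum_{ab\in E}w_{ab}(e_a-e_b)(e_a-e_b)^T$ be the weighted Laplacian, with eigenvalues $\lambda_1(w)\le\lambda_2(w)\le\dots\le\lambda_n(w)$ (with multiplicity), and let $L=\mathcal{L}(\mathbb{1})$ be the unweighted Laplacian, where $\mathbb{1}\in\mathbb{R}^E$ is the all-ones vector. Let $\mathcal{L}^*$ be the adjoint of $\mathcal{L}$ with respect to the trace inner product, so that $\mathcal{L}^*(X)_{ab}=(e_a-e_b)^TX(e_a-e_b)=X_{aa}+X_{bb}-2X_{ab}$ for every symmetric $X\in\mathbb{R}^{V\times V}$ and $ab\in E$. Let $\Delta_E=\{w\in\mathbb{R}^E: w\ge 0,\ \sum_{e\in E}w_e=|E|\}$; for $w\in\Delta_E$ we have $\lambda_1(w)=0$, and $\lambda_2(w),\dots,\lambda_n(w)$ are called the nontrivial eigenvalues of $\mathcal{L}(w)$. For $k\in\{1,\dots,n-1\}$ let $s_k(w)=\sum_{i=2}^{k+1}\lambda_i(w)$ and $S_k(w)=\sum_{i=n-k+1}^{n}\lambda_i(w)$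 be the sums of the $k$ smallest and of the $k$ largest nontrivial eigenvalues. The graph $G$ is *totally conformally rigid* if for every $k\in\{1,\dots,n-1\}$ and all $w,w'\in\Delta_E$, $$s_k(w)\le s_k(\mathbb{1})\le S_k(\mathbb{1})\le S_k(w').$$ The graph $G$ is *edge-rigid* if for every nonzero eigenvalue $\mu$ of $L$, with $E_\mu$ the orthogonal projector of $\mathbb{R}^V$ onto the $\mu$-eigenspace of $L$, there is a constant $\gamma_\mu>0$ such that $\mathcal{L}^*(E_\mu)=\gamma_\mu\mathbb{1}$. **Theorem.** $G$ is totally conformally rigid if and only if it is edge-rigid. -/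

import Mathlib

open scoped Matrix

namespace ConformalRigidity

noncomputable section

/-- The vector `z_{ab} = e_a - e_b`. -/
def edgeVec {V : Type*} [DecidableEq V] (a b : V) : V → ℝ :=
  Pi.single a 1 - Pi.single b 1

theorem edgeVec_swap {V : Type*} [DecidableEq V] (a b : V) : edgeVec a b = -edgeVec b a := by
  simp [edgeVec]

/-- The rank-one matrix `L_{ab} = z_{ab} z_{ab}ᵀ`, which does not depend on the order of the two
endpoints of the edge `ab`. -/
def edgeLaplacian {V : Type*} [DecidableEq V] : Sym2 V → Matrix V V ℝ :=
  Sym2.lift ⟨fun a b => Matrix.vecMulVec (edgeVec a b) (edgeVec a b), fun a b => by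
    beta_reduce; rw [edgeVec_swap a b]; simp [Matrix.neg_vecMulVec, Matrix.vecMulVec_neg]⟩

/-- The weighted Laplacian `𝓛(w) = ∑_{ab ∈ E} w_{ab} z_{ab} z_{ab}ᵀ`. -/
def weightedLaplacian {V : Type*} [Fintype V] [DecidableEq V] (G : SimpleGraph V)
    [DecidableRel G.Adj] (w : G.edgeSet → ℝ) : Matrix V V ℝ :=
  ∑ e : G.edgeSet, w e • edgeLaplacian (e : Sym2 V)

/-- The adjoint `𝓛*` of the weighted Laplacian, `𝓛*(X)_{ab} = z_{ab}ᵀ X z_{ab}`. -/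
def laplacianAdjoint {V : Type*} [Fintype V] [DecidableEq V] (G : SimpleGraph V)
    (X : Matrix V V ℝ) (e : G.edgeSet) : ℝ :=
  Sym2.lift ⟨fun a b => edgeVec a b ⬝ᵥ (X *ᵥ edgeVec a b), fun a b => by
    beta_reduce; rw [edgeVec_swap a b]; simp [Matrix.mulVec_neg]⟩ (e : Sym2 V)

/-- The simplex `Δ_E` of edge weights `w ≥ 0` of total weight `|E|`. -/
def weightSimplex {V : Type*} [Fintype V] [DecidableEq V] (G : SimpleGraph V)
    [DecidableRel G.Adj] : Set (G.edgeSet → ℝ) :=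
  {w | (∀ e, 0 ≤ w e) ∧ ∑ e, w e = (Fintype.card G.edgeSet : ℝ)}

theorem edgeLaplacian_isHermitian {V : Type*} [DecidableEq V] (e : Sym2 V) :
    (edgeLaplacian e).IsHermitian := by
  induction e using Sym2.ind with
  | _ a b =>
    ext i j
    simp [edgeLaplacian, Matrix.vecMulVec_apply, mul_comm]

theorem weightedLaplacian_isHermitian {V : Type*} [Fintype V] [DecidableEq V] (G : SimpleGraph V)
    [DecidableRel G.Adj] (w : G.edgeSet → ℝ) : (weightedLaplacian G w).IsHermitian := by
  unfold Matrix.IsHermitian weightedLaplacian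
  rw [Matrix.conjTranspose_sum]
  refine Finset.sum_congr rfl fun e _ => ?_
  rw [Matrix.conjTranspose_smul, (edgeLaplacian_isHermitian (e : Sym2 V)).eq, star_trivial]

/-- The eigenvalues of `𝓛(w)`, with multiplicity, in nondecreasing order. The indices start
at `0`, so `eigenvalue G w 0` is the trivial eigenvalue `λ₁(w)`, which is `0` if `w ≥ 0`. -/
def eigenvalue {V : Type*} [Fintype V] [DecidableEq V] (G : SimpleGraph V)
    [DecidableRel G.Adj] (w : G.edgeSet → ℝ) (i : Fin (Fintype.card V)) : ℝ :=
  (weightedLaplacian_isHermitian G w).eigenvalues₀ i.rev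

theorem eigenvalue_monotone {V : Type*} [Fintype V] [DecidableEq V] (G : SimpleGraph V)
    [DecidableRel G.Adj] (w : G.edgeSet → ℝ) : Monotone (eigenvalue G w) := fun _ _ h =>
  (weightedLaplacian_isHermitian G w).eigenvalues₀_antitone (Fin.rev_le_rev.mpr h)

/-- `s_k(w) = λ₂(w) + ⋯ + λ_{k+1}(w)`, the sum of the `k` smallest nontrivial eigenvalues,
for `1 ≤ k ≤ n - 1`. -/
def sumSmallest {V : Type*} [Fintype V] [DecidableEq V] (G : SimpleGraph V)
    [DecidableRel G.Adj] (k : ℕ) (w : G.edgeSet → ℝ) : ℝ :=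
  ∑ i : Fin (Fintype.card V) with 1 ≤ i.val ∧ i.val ≤ k, eigenvalue G w i

/-- `S_k(w) = λ_{n-k+1}(w) + ⋯ + λ_n(w)`, the sum of the `k` largest nontrivial eigenvalues,
for `1 ≤ k ≤ n - 1`. -/
def sumLargest {V : Type*} [Fintype V] [DecidableEq V] (G : SimpleGraph V)
    [DecidableRel G.Adj] (k : ℕ) (w : G.edgeSet → ℝ) : ℝ :=
  ∑ i : Fin (Fintype.card V) with Fintype.card V ≤ i.val + k, eigenvalue G w i

/-- `k`-conformal rigidity: `s_k(w) ≤ s_k(𝟙) ≤ S_k(𝟙) ≤ S_k(w')` for all `w, w' ∈ Δ_E`. -/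
def IsConformallyRigid {V : Type*} [Fintype V] [DecidableEq V] (G : SimpleGraph V)
    [DecidableRel G.Adj] (k : ℕ) : Prop :=
  ∀ w ∈ weightSimplex G, ∀ w' ∈ weightSimplex G,
    sumSmallest G k w ≤ sumSmallest G k 1 ∧ sumSmallest G k 1 ≤ sumLargest G k 1 ∧
      sumLargest G k 1 ≤ sumLargest G k w'

/-- Total conformal rigidity: `k`-conformal rigidity for every `k ∈ {1, …, n - 1}`. -/
def IsTotallyConformallyRigid {V : Type*} [Fintype V] [DecidableEq V] (G : SimpleGraph V)
    [DecidableRel G.Adj] : Prop :=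
  ∀ k : ℕ, 1 ≤ k → k < Fintype.card V → IsConformallyRigid G k

/-- The matrix of the orthogonal projection of `ℝ^V` onto the eigenspace of the matrix `A` for
`μ`. -/
def eigenprojector {V : Type*} [Fintype V] [DecidableEq V] (A : Matrix V V ℝ) (μ : ℝ) :
    Matrix V V ℝ :=
  Matrix.toEuclideanLin.symm
    ((Module.End.eigenspace (Matrix.toEuclideanLin A) μ).starProjection :
      EuclideanSpace ℝ V →ₗ[ℝ] EuclideanSpace ℝ V)

/-- Edge-rigidity: for every nonzero eigenvalue `μ` of the unweighted Laplacian `L = 𝓛(𝟙)`, with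
eigenprojector `E`, there is `γ > 0` with `𝓛*(E) = γ 𝟙`. -/
def IsEdgeRigid {V : Type*} [Fintype V] [DecidableEq V] (G : SimpleGraph V)
    [DecidableRel G.Adj] : Prop :=
  ∀ μ : ℝ, Module.End.HasEigenvalue (Matrix.toEuclideanLin (weightedLaplacian G 1)) μ → μ ≠ 0 →
    ∃ γ : ℝ, 0 < γ ∧
      ∀ e : G.edgeSet, laplacianAdjoint G (eigenprojector (weightedLaplacian G 1) μ) e = γ

/-- `𝓛*` is the adjoint of `𝓛` for the trace inner product. -/
theorem trace_weightedLaplacian_mul_transpose {V : Type*} [Fintype V] [DecidableEq V]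
    (G : SimpleGraph V) [DecidableRel G.Adj] (w : G.edgeSet → ℝ) (X : Matrix V V ℝ) :
    (weightedLaplacian G w * Xᵀ).trace = ∑ e, w e * laplacianAdjoint G X e := by
  unfold weightedLaplacian
  rw [Finset.sum_mul, Matrix.trace_sum]
  refine Finset.sum_congr rfl fun e _ => ?_
  rw [Matrix.smul_mul, Matrix.trace_smul, smul_eq_mul]
  congr 1
  obtain ⟨e, he⟩ := e
  induction e using Sym2.ind with
  | _ a b =>
    simp only [edgeLaplacian, laplacianAdjoint, Sym2.lift_mk]
    rw [Matrix.vecMulVec_mul, Matrix.trace_vecMulVec, Matrix.vecMul_transpose]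

end

end ConformalRigidity

/-! Both directions compare the diagonals of matrices `P` with `0 ≤ P ≤ 1` in an eigenbasis of
`𝓛(w)`, in the spirit of Ky Fan's principle.

If `G` is edge-rigid, let `P` be a linear combination of eigenprojectors of `L`. Then `𝓛*(P)` is
constant (`𝓛*(E_0) = 0`), so `tr(𝓛(w) P)` is the same for all `w ∈ Δ_E`. For an index set `S`,
averaging its indicator over equal eigenvalues gives such a `P`, with `tr(L P) = ∑_{j ∈ S} λ_j(𝟙)`.
In an eigenbasis of `𝓛(w)` the same number reads `∑ λ_j(w) d_j` with `0 ≤ d_j ≤ 1` and `∑ d_j =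
|S|`, which lies between the sums of the `|S|` smallest and the `|S|` largest `λ_j(w)`
(`sum_eigenvalue_one_eq`, `sum_le_sum_mul_of_le`).

Conversely, let `P` project onto the eigenvalues of `L` that are at most `μ`. Across this spectral
gap the eigenvalue sum has first-order term `t · tr(𝓛(h) P)` along `𝟙 + t h`, with an error of order
`t²` (`sum_eigenvalue_add_le`). Moving weight from an edge `f` to an edge `e` cannot increase the
sum, so `𝓛*(P)_e ≤ 𝓛*(P)_f`; by symmetry `𝓛*(P)` is constant. Differences of such `P` are the
eigenprojectors. -/

namespace ConformalRigidity

noncomputable section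

/-! ### Weighted sums against sums over extreme index sets, and averages over fibres. -/

section Majorization

variable {ι : Type*} [Fintype ι]

/-- Mass `|S| - ∑_S d` has moved from values at most `τ` to values at least `τ + δ`, at a cost of at
least `δ` per unit. This surplus later absorbs a second-order error; `δ = 0` gives the Ky Fan bound.
-/
theorem sum_add_gap_mul_le [DecidableEq ι] {a d : ι → ℝ} {S : Finset ι} {τ δ : ℝ}
    (h0 : ∀ i, 0 ≤ d i) (h1 : ∀ i, d i ≤ 1) (hd : ∑ i, d i = S.card)
    (hS : ∀ i ∈ S, a i ≤ τ) (hSc : ∀ i ∉ S, τ + δ ≤ a i) :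
    ∑ i ∈ S, a i + δ * (S.card - ∑ i ∈ S, d i) ≤ ∑ i, a i * d i := by
  have e1 : ∑ i ∈ S, (a i - τ) * (1 - d i) ≤ 0 :=
    Finset.sum_nonpos fun i hi =>
      mul_nonpos_of_nonpos_of_nonneg (by linarith [hS i hi]) (by linarith [h1 i])
  have e2 : 0 ≤ ∑ i ∈ Sᶜ, (a i - τ - δ) * d i :=
    Finset.sum_nonneg fun i hi =>
      mul_nonneg (by linarith [hSc i (Finset.mem_compl.mp hi)]) (h0 i)
  have e3 := Finset.sum_add_sum_compl S d
  have e4 := Finset.sum_add_sum_compl S fun i => a i * d i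
  simp only [sub_mul, mul_sub, mul_one, Finset.sum_sub_distrib, ← Finset.mul_sum,
    Finset.sum_const, nsmul_eq_mul] at e1 e2
  rw [← e4]
  have e5 : ∑ i ∈ Sᶜ, d i = S.card - ∑ i ∈ S, d i := by linarith
  rw [e5] at e2
  linarith

theorem exists_separating_value {a : ι → ℝ} {S : Finset ι}
    (h : ∀ i ∈ S, ∀ j ∉ S, a i ≤ a j) : ∃ τ, (∀ i ∈ S, a i ≤ τ) ∧ ∀ j ∉ S, τ ≤ a j := by
  rcases S.eq_empty_or_nonempty with rfl | hS
  · obtain ⟨τ, hτ⟩ := (Set.finite_range a).bddBelow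
    exact ⟨τ, by simp, fun j _ => hτ ⟨j, rfl⟩⟩
  · obtain ⟨i, hi, hmax⟩ := S.exists_max_image a hS
    exact ⟨a i, hmax, fun j hj => h i hi j hj⟩

theorem sum_le_sum_mul_of_le {a d : ι → ℝ} {S : Finset ι}
    (h0 : ∀ i, 0 ≤ d i) (h1 : ∀ i, d i ≤ 1) (hd : ∑ i, d i = S.card)
    (h : ∀ i ∈ S, ∀ j ∉ S, a i ≤ a j) : ∑ i ∈ S, a i ≤ ∑ i, a i * d i := by
  classical
  obtain ⟨τ, hS, hSc⟩ := exists_separating_value h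
  simpa using sum_add_gap_mul_le (δ := 0) h0 h1 hd hS (by simpa using hSc)

theorem sum_mul_le_sum_of_le {a d : ι → ℝ} {S : Finset ι}
    (h0 : ∀ i, 0 ≤ d i) (h1 : ∀ i, d i ≤ 1) (hd : ∑ i, d i = S.card)
    (h : ∀ i ∈ S, ∀ j ∉ S, a j ≤ a i) : ∑ i, a i * d i ≤ ∑ i ∈ S, a i := by
  have := sum_le_sum_mul_of_le (a := fun i => -a i) h0 h1 hd
    fun i hi j hj => neg_le_neg (h i hi j hj)
  simpa [Finset.sum_neg_distrib] using this

/-- The average of the indicator function of `S` over the fibre of `a` through `i`. -/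
def fiberAverage (a : ι → ℝ) (S : Finset ι) (i : ι) : ℝ :=
  ∑ j ∈ S, if a j = a i then ((Finset.univ.filter fun l => a l = a j).card : ℝ)⁻¹ else 0

theorem fiberAverage_nonneg (a : ι → ℝ) (S : Finset ι) (i : ι) : 0 ≤ fiberAverage a S i :=
  Finset.sum_nonneg fun j _ => by split_ifs <;> positivity

theorem fiberAverage_le_one (a : ι → ℝ) (S : Finset ι) (i : ι) : fiberAverage a S i ≤ 1 := by
  have hpos : (0 : ℝ) < (Finset.univ.filter fun l => a l = a i).card := by
    exact_mod_cast Finset.card_pos.mpr ⟨i, by simp⟩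
  calc fiberAverage a S i
      ≤ ∑ j, if a j = a i then ((Finset.univ.filter fun l => a l = a j).card : ℝ)⁻¹ else 0 :=
        Finset.sum_le_sum_of_subset_of_nonneg (Finset.subset_univ S) fun j _ _ => by
          split_ifs <;> positivity
    _ = ∑ j with a j = a i, ((Finset.univ.filter fun l => a l = a i).card : ℝ)⁻¹ := by
        rw [Finset.sum_filter]
        refine Finset.sum_congr rfl fun j _ => ?_
        split_ifs with h
        · rw [h]
        · rfl
    _ = 1 := by
        rw [Finset.sum_const, nsmul_eq_mul, mul_inv_cancel₀ hpos.ne']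

theorem sum_fiberAverage_mul (a : ι → ℝ) (S : Finset ι) (h : ι → ℝ) :
    ∑ i, fiberAverage a S i * h i = ∑ j ∈ S,
      ((Finset.univ.filter fun l => a l = a j).card : ℝ)⁻¹ * ∑ i with a i = a j, h i := by
  simp only [fiberAverage, Finset.sum_mul]
  rw [Finset.sum_comm]
  refine Finset.sum_congr rfl fun j _ => ?_
  rw [Finset.mul_sum, Finset.sum_filter]
  refine Finset.sum_congr rfl fun i _ => ?_
  by_cases hij : a i = a j
  · rw [if_pos hij, if_pos hij.symm]
  · rw [if_neg hij, if_neg (Ne.symm hij), zero_mul]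

theorem sum_fiberAverage_mul_comp (a : ι → ℝ) (S : Finset ι) (f : ℝ → ℝ) :
    ∑ i, fiberAverage a S i * f (a i) = ∑ j ∈ S, f (a j) := by
  rw [sum_fiberAverage_mul]
  refine Finset.sum_congr rfl fun j _ => ?_
  have hpos : (0 : ℝ) < (Finset.univ.filter fun l => a l = a j).card := by
    exact_mod_cast Finset.card_pos.mpr ⟨j, by simp⟩
  rw [Finset.sum_congr rfl (g := fun _ => f (a j)) fun i hi => by
      rw [(Finset.mem_filter.mp hi).2],
    Finset.sum_const, nsmul_eq_mul, inv_mul_cancel_left₀ hpos.ne']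

theorem exists_gap_above (a : ι → ℝ) (μ : ℝ) : ∃ δ > 0, ∀ i, μ < a i → μ + δ ≤ a i := by
  classical
  rcases (Finset.univ.filter fun i => μ < a i).eq_empty_or_nonempty with h | h
  · refine ⟨1, one_pos, fun i hi => ?_⟩
    exact absurd hi (by simpa using (Finset.filter_eq_empty_iff.mp h) (Finset.mem_univ i))
  · obtain ⟨i, hi, hmin⟩ := Finset.exists_min_image _ a h
    refine ⟨a i - μ, sub_pos.mpr (Finset.mem_filter.mp hi).2, fun j hj => ?_⟩
    have := hmin j (by simpa using hj)
    linarith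

end Majorization

theorem val_lt_card_iff_mem {n : ℕ} {S : Finset (Fin n)}
    (h : ∀ i ∈ S, ∀ j ≤ i, j ∈ S) (i : Fin n) : i.val < S.card ↔ i ∈ S := by
  constructor
  · intro hi
    by_contra hn
    have : S ⊆ Finset.Iio i := fun j hj => by
      rw [Finset.mem_Iio]
      by_contra hij
      exact hn (h j hj i (not_lt.mp hij))
    have := Finset.card_le_card this
    rw [Fin.card_Iio] at this
    omega
  · intro hi
    have : Finset.Iic i ⊆ S := fun j hj => h i hi j (Finset.mem_Iic.mp hj)
    have := Finset.card_le_card this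
    rw [Fin.card_Iic] at this
    omega

/-! ### Change of orthonormal basis as a doubly stochastic matrix. -/

section OrthonormalBases

variable {ι E : Type*} [Fintype ι] [NormedAddCommGroup E] [InnerProductSpace ℝ E]

theorem sum_inner_sq_right (b : OrthonormalBasis ι ℝ E) (x : E) :
    ∑ i, (inner ℝ (b i) x) ^ 2 = ‖x‖ ^ 2 := by
  simpa [sq_abs] using b.sum_sq_norm_inner_right x

/-- The sums are the diagonal entries, in the basis `v`, of the operator with eigenvalues `c` on
`b`. This lemma and the next two supply the hypotheses on `d` in the majorization bounds. -/
theorem sum_sum_mul_inner_sq (b v : OrthonormalBasis ι ℝ E) (c : ι → ℝ) :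
    ∑ j, ∑ i, c i * (inner ℝ (v j) (b i)) ^ 2 = ∑ i, c i := by
  rw [Finset.sum_comm]
  refine Finset.sum_congr rfl fun i _ => ?_
  rw [← Finset.mul_sum, sum_inner_sq_right, b.norm_eq_one]
  norm_num

theorem sum_mul_inner_sq_nonneg (b v : OrthonormalBasis ι ℝ E) {c : ι → ℝ}
    (h0 : ∀ i, 0 ≤ c i) (j : ι) : 0 ≤ ∑ i, c i * (inner ℝ (v j) (b i)) ^ 2 :=
  Finset.sum_nonneg fun i _ => mul_nonneg (h0 i) (sq_nonneg _)

theorem sum_mul_inner_sq_le_one (b v : OrthonormalBasis ι ℝ E) {c : ι → ℝ}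
    (h1 : ∀ i, c i ≤ 1) (j : ι) : ∑ i, c i * (inner ℝ (v j) (b i)) ^ 2 ≤ 1 := by
  calc ∑ i, c i * (inner ℝ (v j) (b i)) ^ 2 ≤ ∑ i, (inner ℝ (b i) (v j)) ^ 2 :=
        Finset.sum_le_sum fun i _ => by
          rw [real_inner_comm]
          exact mul_le_of_le_one_left (sq_nonneg _) (h1 i)
    _ = 1 := by rw [sum_inner_sq_right, v.norm_eq_one]; norm_num

end OrthonormalBases

/-! ### Frobenius geometry of the projectors spanned by parts of two bases. -/

section Frobenius

variable {V : Type*} [Fintype V] {ι : Type*} [Fintype ι]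

/-- The entries of `∑_{i ∈ S} v_i v_iᵀ`. -/
def partialGram (v : OrthonormalBasis ι ℝ (EuclideanSpace ℝ V)) (S : Finset ι) (x y : V) : ℝ :=
  ∑ i ∈ S, v i x * v i y

theorem sum_partialGram_mul (v b : OrthonormalBasis ι ℝ (EuclideanSpace ℝ V)) (S T : Finset ι) :
    ∑ x, ∑ y, partialGram v S x y * partialGram b T x y =
      ∑ j ∈ S, ∑ i ∈ T, (inner ℝ (v j) (b i)) ^ 2 := by
  have hin : ∀ j i, inner ℝ (v j) (b i) = ∑ x, v j x * b i x := fun j i => by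
    simp [PiLp.inner_apply, mul_comm]
  simp only [hin, sq, Finset.sum_mul_sum, partialGram]
  simp only [Finset.sum_comm (s := (Finset.univ : Finset V)) (t := S),
    Finset.sum_comm (s := (Finset.univ : Finset V)) (t := T)]
  refine Finset.sum_congr rfl fun j _ => Finset.sum_congr rfl fun i _ =>
    Finset.sum_congr rfl fun x _ => Finset.sum_congr rfl fun y _ => by ring

theorem sum_sum_inner_sq_self (b : OrthonormalBasis ι ℝ (EuclideanSpace ℝ V)) (S : Finset ι) :
    ∑ j ∈ S, ∑ i ∈ S, (inner ℝ (b j) (b i)) ^ 2 = (S.card : ℝ) := by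
  classical
  simp only [b.inner_eq_ite, ite_pow]
  rw [Finset.card_eq_sum_ones, Nat.cast_sum]
  refine Finset.sum_congr rfl fun j hj => ?_
  simp [Finset.sum_ite_eq, hj]

theorem sum_dotProduct_mulVec (v : OrthonormalBasis ι ℝ (EuclideanSpace ℝ V)) (S : Finset ι)
    (H : Matrix V V ℝ) :
    ∑ i ∈ S, (v i).ofLp ⬝ᵥ (H *ᵥ (v i).ofLp) = ∑ x, ∑ y, H x y * partialGram v S x y := by
  simp only [partialGram, dotProduct, Matrix.mulVec, Finset.mul_sum]
  rw [Finset.sum_comm]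
  refine Finset.sum_congr rfl fun x _ => ?_
  rw [Finset.sum_comm]
  refine Finset.sum_congr rfl fun y _ => Finset.sum_congr rfl fun i _ => by ring

/-- With `P_v`, `P_b` the two projectors, this is Young's inequality for `t⟨H, P_b - P_v⟩`, the
quadratic term being `δ/2 · ‖P_v - P_b‖²`. That term has exactly the form of the surplus in
`sum_add_gap_mul_le`. -/
theorem smul_sum_dotProduct_mulVec_le (b v : OrthonormalBasis ι ℝ (EuclideanSpace ℝ V))
    (S : Finset ι) (H : Matrix V V ℝ) {δ : ℝ} (hδ : 0 < δ) (t : ℝ) :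
    t * ∑ i ∈ S, (b i).ofLp ⬝ᵥ (H *ᵥ (b i).ofLp) ≤
      t * ∑ j ∈ S, (v j).ofLp ⬝ᵥ (H *ᵥ (v j).ofLp) +
      δ * (S.card - ∑ j ∈ S, ∑ i ∈ S, (inner ℝ (v j) (b i)) ^ 2) +
      t ^ 2 * ((∑ x, ∑ y, H x y ^ 2) / (2 * δ)) := by
  have key : ∑ x, ∑ y, (partialGram v S x y - partialGram b S x y) ^ 2 =
      2 * (S.card - ∑ j ∈ S, ∑ i ∈ S, (inner ℝ (v j) (b i)) ^ 2) := by
    have h1 := sum_partialGram_mul v v S S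
    have h2 := sum_partialGram_mul v b S S
    have h3 := sum_partialGram_mul b b S S
    rw [sum_sum_inner_sq_self] at h1 h3
    rw [← h2]
    calc _ = ∑ x, ∑ y, (partialGram v S x y * partialGram v S x y -
          2 * (partialGram v S x y * partialGram b S x y) +
          partialGram b S x y * partialGram b S x y) :=
          Finset.sum_congr rfl fun x _ => Finset.sum_congr rfl fun y _ => by ring
      _ = _ := by
          simp only [Finset.sum_add_distrib, Finset.sum_sub_distrib, ← Finset.mul_sum]
          rw [h1, h3]; ring
  have hpt : ∀ x y, t * (H x y * partialGram b S x y) ≤ t * (H x y * partialGram v S x y) +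
      δ / 2 * (partialGram v S x y - partialGram b S x y) ^ 2 +
      t ^ 2 / (2 * δ) * H x y ^ 2 := fun x y => by
    set X := partialGram v S x y
    set Y := partialGram b S x y
    -- Completing the square in `X - Y`.
    have : t * (H x y * X) + δ / 2 * (X - Y) ^ 2 + t ^ 2 / (2 * δ) * H x y ^ 2
        - t * (H x y * Y) = (δ * (X - Y) + t * H x y) ^ 2 / (2 * δ) := by
      field_simp; ring
    have h' : 0 ≤ (δ * (X - Y) + t * H x y) ^ 2 / (2 * δ) := by positivity
    linarith
  have := Finset.sum_le_sum fun x (_ : x ∈ Finset.univ) =>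
    Finset.sum_le_sum fun y (_ : y ∈ Finset.univ) => hpt x y
  simp only [Finset.sum_add_distrib, ← Finset.mul_sum] at this
  rw [key] at this
  rw [sum_dotProduct_mulVec, sum_dotProduct_mulVec]
  calc _ ≤ _ := this
    _ = _ := by ring

end Frobenius

/-! ### Quadratic forms and spectral decomposition of weighted Laplacians. -/

section Spectral

variable {V : Type*} [Fintype V] [DecidableEq V]

/-- The quadratic form of the Laplacian of a single edge. -/
def edgeForm (e : Sym2 V) (x : V → ℝ) : ℝ := x ⬝ᵥ (edgeLaplacian e *ᵥ x)

theorem edgeForm_mk (a b : V) (x : V → ℝ) : edgeForm s(a, b) x = (edgeVec a b ⬝ᵥ x) ^ 2 := by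
  simp only [edgeForm, edgeLaplacian, Sym2.lift_mk, Matrix.vecMulVec_mulVec]
  simp [dotProduct_comm x, sq]

theorem edgeForm_nonneg (e : Sym2 V) (x : V → ℝ) : 0 ≤ edgeForm e x := by
  induction e using Sym2.ind with
  | _ a b => rw [edgeForm_mk]; positivity

theorem edgeForm_const (e : Sym2 V) : edgeForm e (fun _ => 1) = 0 := by
  induction e using Sym2.ind with
  | _ a b => simp [edgeForm_mk, edgeVec, sub_dotProduct]

variable (G : SimpleGraph V) [DecidableRel G.Adj]

theorem dotProduct_weightedLaplacian_mulVec (w : G.edgeSet → ℝ) (x : V → ℝ) :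
    x ⬝ᵥ (weightedLaplacian G w *ᵥ x) = ∑ e, w e * edgeForm (e : Sym2 V) x := by
  simp [weightedLaplacian, Matrix.sum_mulVec, dotProduct_sum, Matrix.smul_mulVec, edgeForm]

omit [DecidableRel G.Adj] in
theorem laplacianAdjoint_sum_vecMulVec {ι : Type*} (S : Finset ι) (v : ι → V → ℝ)
    (e : G.edgeSet) :
    laplacianAdjoint G (∑ i ∈ S, Matrix.vecMulVec (v i) (v i)) e =
      ∑ i ∈ S, edgeForm (e : Sym2 V) (v i) := by
  obtain ⟨e, he⟩ := e
  induction e using Sym2.ind with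
  | _ a b =>
    simp only [laplacianAdjoint, Sym2.lift_mk, edgeForm_mk, Matrix.sum_mulVec, dotProduct_sum,
      Matrix.vecMulVec_mulVec]
    refine Finset.sum_congr rfl fun i _ => ?_
    simp [dotProduct_comm (v i), sq]

/-- The order-reversing enumeration of the eigenvalue indices used in `eigenvalue`. -/
def indexEquiv (V : Type*) [Fintype V] [DecidableEq V] : Fin (Fintype.card V) ≃ V :=
  Fin.revPerm.trans (Fintype.equivOfCardEq (Fintype.card_fin _))

/-- An orthonormal basis of eigenvectors of `𝓛(w)`, ordered as `eigenvalue G w`. -/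
def eigenBasis (w : G.edgeSet → ℝ) :
    OrthonormalBasis (Fin (Fintype.card V)) ℝ (EuclideanSpace ℝ V) :=
  (weightedLaplacian_isHermitian G w).eigenvectorBasis.reindex (indexEquiv V).symm

theorem weightedLaplacian_mulVec_eigenBasis (w : G.edgeSet → ℝ) (i : Fin (Fintype.card V)) :
    weightedLaplacian G w *ᵥ (eigenBasis G w i).ofLp =
      eigenvalue G w i • (eigenBasis G w i).ofLp := by
  have h := (weightedLaplacian_isHermitian G w).mulVec_eigenvectorBasis (indexEquiv V i)
  simpa [eigenBasis, eigenvalue, Matrix.IsHermitian.eigenvalues, indexEquiv] using h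

theorem sum_mul_edgeForm_eq (w : G.edgeSet → ℝ) (x : EuclideanSpace ℝ V) :
    ∑ e, w e * edgeForm (e : Sym2 V) x.ofLp =
      ∑ j, eigenvalue G w j * (inner ℝ (eigenBasis G w j) x) ^ 2 := by
  rw [← dotProduct_weightedLaplacian_mulVec]
  have h1 : x.ofLp ⬝ᵥ (weightedLaplacian G w *ᵥ x.ofLp) =
      inner ℝ x (WithLp.toLp 2 (weightedLaplacian G w *ᵥ x.ofLp)) := by
    simp [EuclideanSpace.inner_eq_star_dotProduct, dotProduct_comm]
  rw [h1, ← (eigenBasis G w).sum_inner_mul_inner]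
  refine Finset.sum_congr rfl fun j _ => ?_
  have h2 : inner ℝ (eigenBasis G w j) (WithLp.toLp 2 (weightedLaplacian G w *ᵥ x.ofLp)) =
      eigenvalue G w j * inner ℝ (eigenBasis G w j) x := by
    have hT : (weightedLaplacian G w)ᵀ = weightedLaplacian G w := by
      simpa [Matrix.IsHermitian, Matrix.conjTranspose_eq_transpose_of_trivial] using
        weightedLaplacian_isHermitian G w
    simp only [EuclideanSpace.inner_eq_star_dotProduct, star_trivial]
    rw [dotProduct_comm, Matrix.dotProduct_mulVec, ← Matrix.mulVec_transpose, hT,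
      weightedLaplacian_mulVec_eigenBasis, smul_dotProduct, smul_eq_mul, dotProduct_comm]
  rw [h2, real_inner_comm]
  ring

theorem sum_mul_edgeForm_eigenBasis (w : G.edgeSet → ℝ) (i : Fin (Fintype.card V)) :
    ∑ e, w e * edgeForm (e : Sym2 V) (eigenBasis G w i).ofLp = eigenvalue G w i := by
  simp [sum_mul_edgeForm_eq, (eigenBasis G w).inner_eq_ite]

theorem eigenvalue_nonneg {w : G.edgeSet → ℝ} (hw : ∀ e, 0 ≤ w e) (i : Fin (Fintype.card V)) :
    0 ≤ eigenvalue G w i := by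
  rw [← sum_mul_edgeForm_eigenBasis]
  exact Finset.sum_nonneg fun e _ => mul_nonneg (hw e) (edgeForm_nonneg _ _)

theorem eigenvalue_eq_zero_of_val_eq_zero {w : G.edgeSet → ℝ} (hw : ∀ e, 0 ≤ w e)
    {i : Fin (Fintype.card V)} (hi : i.val = 0) : eigenvalue G w i = 0 := by
  by_contra hne
  have hpos : 0 < eigenvalue G w i := lt_of_le_of_ne (eigenvalue_nonneg G hw i) (Ne.symm hne)
  have hall : ∀ j, 0 < eigenvalue G w j := fun j =>
    hpos.trans_le (eigenvalue_monotone G w (by rw [Fin.le_def, hi]; exact Nat.zero_le _))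
  -- The form vanishes on the all-ones vector, which is impossible if every eigenvalue is positive.
  let x : EuclideanSpace ℝ V := WithLp.toLp 2 fun _ => 1
  have h := sum_mul_edgeForm_eq G w x
  have hz : ∑ e : G.edgeSet, w e * edgeForm (e : Sym2 V) x.ofLp = 0 :=
    Finset.sum_eq_zero fun e _ => by rw [edgeForm_const, mul_zero]
  rw [hz, eq_comm, Finset.sum_eq_zero_iff_of_nonneg
    fun j _ => mul_nonneg (hall j).le (sq_nonneg _)] at h
  have hn := sum_inner_sq_right (eigenBasis G w) x
  rw [Finset.sum_eq_zero fun j hj => (mul_eq_zero.mp (h j hj)).resolve_left (hall j).ne'] at hn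
  have hx : x = 0 := by simpa using hn.symm
  have : x (indexEquiv V i) = 0 := by rw [hx]; rfl
  exact one_ne_zero this

theorem one_mem_weightSimplex : (1 : G.edgeSet → ℝ) ∈ weightSimplex G :=
  ⟨fun _ => zero_le_one, by simp⟩

/-- Adjoining the trivial index `0` costs nothing and turns the index set of `s_k` into an initial
segment of size `k + 1`. -/
theorem sum_filter_lt_eigenvalue {w : G.edgeSet → ℝ} (hw : ∀ e, 0 ≤ w e) (k : ℕ) :
    ∑ i with i.val < k + 1, eigenvalue G w i = sumSmallest G k w := by
  unfold sumSmallest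
  symm
  refine Finset.sum_subset (fun i hi => ?_) fun i hi hi' => ?_
  · simp at hi ⊢; omega
  · simp at hi hi'
    exact eigenvalue_eq_zero_of_val_eq_zero G hw (by omega)

/-! ### Eigenprojectors -/

theorem toEuclideanLin_eigenBasis (w : G.edgeSet → ℝ) (i : Fin (Fintype.card V)) :
    Matrix.toEuclideanLin (weightedLaplacian G w) (eigenBasis G w i) =
      eigenvalue G w i • eigenBasis G w i := by
  ext v
  have := congrFun (weightedLaplacian_mulVec_eigenBasis G w i) v
  simpa [Matrix.toLpLin_apply] using this

theorem inner_eigenBasis_eq_zero {w : G.edgeSet → ℝ} {μ : ℝ} {x : EuclideanSpace ℝ V}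
    (hx : x ∈ Module.End.eigenspace (Matrix.toEuclideanLin (weightedLaplacian G w)) μ)
    {i : Fin (Fintype.card V)} (hi : eigenvalue G w i ≠ μ) :
    inner ℝ (eigenBasis G w i) x = 0 := by
  have hs := Matrix.isSymmetric_toEuclideanLin_iff.mpr (weightedLaplacian_isHermitian G w)
  have h := hs (eigenBasis G w i) x
  rw [Module.End.mem_eigenspace_iff.mp hx, toEuclideanLin_eigenBasis, real_inner_smul_left,
    real_inner_smul_right] at h
  have : (eigenvalue G w i - μ) * inner ℝ (eigenBasis G w i) x = 0 := by linarith
  exact (mul_eq_zero.mp this).resolve_left (sub_ne_zero.mpr hi)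

theorem hasEigenvalue_eigenvalue (w : G.edgeSet → ℝ) (i : Fin (Fintype.card V)) :
    Module.End.HasEigenvalue (Matrix.toEuclideanLin (weightedLaplacian G w))
      (eigenvalue G w i) :=
  Module.End.hasEigenvalue_of_hasEigenvector
    ⟨Module.End.mem_eigenspace_iff.mpr (toEuclideanLin_eigenBasis G w i),
      (eigenBasis G w).orthonormal.ne_zero i⟩

theorem exists_eigenvalue_eq {w : G.edgeSet → ℝ} {μ : ℝ}
    (h : Module.End.HasEigenvalue (Matrix.toEuclideanLin (weightedLaplacian G w)) μ) :
    ∃ i, eigenvalue G w i = μ := by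
  obtain ⟨x, hx, hx0⟩ := h.exists_hasEigenvector
  by_contra! hne
  have hn := sum_inner_sq_right (eigenBasis G w) x
  rw [Finset.sum_eq_zero fun j _ => by rw [inner_eigenBasis_eq_zero G hx (hne j)]; norm_num] at hn
  exact hx0 (by simpa using hn.symm)

theorem eigenprojector_eq_sum (w : G.edgeSet → ℝ) (μ : ℝ) :
    eigenprojector (weightedLaplacian G w) μ =
      ∑ i with eigenvalue G w i = μ,
        Matrix.vecMulVec (eigenBasis G w i).ofLp (eigenBasis G w i).ofLp := by
  unfold eigenprojector
  rw [LinearEquiv.symm_apply_eq]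
  refine (eigenBasis G w).toBasis.ext fun j => ?_
  have hdot : ∀ i, (eigenBasis G w i).ofLp ⬝ᵥ (eigenBasis G w j).ofLp =
      if i = j then 1 else 0 := fun i => by
    rw [← (eigenBasis G w).inner_eq_ite]
    simp [EuclideanSpace.inner_eq_star_dotProduct, dotProduct_comm]
  have hR : Matrix.toEuclideanLin (∑ i with eigenvalue G w i = μ,
      Matrix.vecMulVec (eigenBasis G w i).ofLp (eigenBasis G w i).ofLp) (eigenBasis G w j) =
      if eigenvalue G w j = μ then eigenBasis G w j else 0 := by
    ext v
    rw [Matrix.toLpLin_apply, Matrix.sum_mulVec]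
    simp only [Matrix.vecMulVec_mulVec, hdot]
    rw [Finset.sum_filter]
    rw [Finset.sum_eq_single j]
    · rw [if_pos rfl]
      split_ifs <;> simp
    · intro i _ hij
      simp [hij]
    · simp
  rw [OrthonormalBasis.coe_toBasis, hR]
  split_ifs with h
  · exact Submodule.starProjection_eq_self_iff.mpr
      (Module.End.mem_eigenspace_iff.mpr (by rw [← h]; exact toEuclideanLin_eigenBasis G w j))
  · refine (Submodule.starProjection_apply_eq_zero_iff _).mpr ?_
    refine (Submodule.mem_orthogonal' _ _).mpr fun x hx => inner_eigenBasis_eq_zero G hx h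

theorem laplacianAdjoint_eigenprojector (w : G.edgeSet → ℝ) (μ : ℝ) (e : G.edgeSet) :
    laplacianAdjoint G (eigenprojector (weightedLaplacian G w) μ) e =
      ∑ i with eigenvalue G w i = μ, edgeForm (e : Sym2 V) (eigenBasis G w i).ofLp := by
  rw [eigenprojector_eq_sum, laplacianAdjoint_sum_vecMulVec]

/-! ### Edge-rigid graphs are totally conformally rigid -/

variable {G}

/-- Extends constancy to every real `μ`: for `μ = 0` nonnegative edge forms sum to zero, and for a
non-eigenvalue the fibre is empty. -/
theorem exists_sum_edgeForm_fiber_eq (h : IsEdgeRigid G) (μ : ℝ) :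
    ∃ γ : ℝ, ∀ e : G.edgeSet,
      ∑ i with eigenvalue G 1 i = μ, edgeForm (e : Sym2 V) (eigenBasis G 1 i).ofLp = γ := by
  by_cases hμ : Module.End.HasEigenvalue (Matrix.toEuclideanLin (weightedLaplacian G 1)) μ
  · by_cases h0 : μ = 0
    · refine ⟨0, fun e => Finset.sum_eq_zero fun i hi => ?_⟩
      have hs := sum_mul_edgeForm_eigenBasis G 1 i
      rw [(Finset.mem_filter.mp hi).2, h0] at hs
      simp only [Pi.one_apply, one_mul] at hs
      exact (Finset.sum_eq_zero_iff_of_nonneg fun e _ => edgeForm_nonneg _ _).mp hs e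
        (Finset.mem_univ e)
    · obtain ⟨γ, -, hγ⟩ := h μ hμ h0
      exact ⟨γ, fun e => by rw [← laplacianAdjoint_eigenprojector]; exact hγ e⟩
  · refine ⟨0, fun e => Finset.sum_eq_zero fun i hi => ?_⟩
    exact absurd ((Finset.mem_filter.mp hi).2 ▸ hasEigenvalue_eigenvalue G 1 i) hμ

theorem sum_eigenvalue_one_eq (h : IsEdgeRigid G) {w : G.edgeSet → ℝ} (hw : w ∈ weightSimplex G)
    (S : Finset (Fin (Fintype.card V))) :
    ∑ j ∈ S, eigenvalue G 1 j = ∑ j, eigenvalue G w j *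
      ∑ i, fiberAverage (eigenvalue G 1) S i *
        (inner ℝ (eigenBasis G w j) (eigenBasis G 1 i)) ^ 2 := by
  choose γ hγ using exists_sum_edgeForm_fiber_eq h
  -- The right-hand side sees `w'` only through its total weight, so the values at `w` and at `𝟙`
  -- agree.
  have hform : ∀ w' ∈ weightSimplex G, ∑ i, fiberAverage (eigenvalue G 1) S i *
      ∑ e, w' e * edgeForm (e : Sym2 V) (eigenBasis G 1 i).ofLp =
      (∑ j ∈ S, ((Finset.univ.filter fun l => eigenvalue G 1 l = eigenvalue G 1 j).card : ℝ)⁻¹ *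
        γ (eigenvalue G 1 j)) * Fintype.card G.edgeSet := fun w' hw' => by
    rw [← hw'.2, Finset.mul_sum]
    simp only [Finset.mul_sum]
    rw [Finset.sum_comm]
    refine Finset.sum_congr rfl fun e _ => ?_
    have := sum_fiberAverage_mul (eigenvalue G 1) S
      fun i => edgeForm (e : Sym2 V) (eigenBasis G 1 i).ofLp
    simp only [hγ] at this
    rw [← this, Finset.sum_mul]
    exact Finset.sum_congr rfl fun i _ => by ring
  have h1 := hform 1 (one_mem_weightSimplex G)
  simp only [sum_mul_edgeForm_eigenBasis] at h1
  have hc := sum_fiberAverage_mul_comp (eigenvalue G 1) S id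
  simp only [id] at hc
  rw [← hc, h1, ← hform w hw]
  simp only [sum_mul_edgeForm_eq, Finset.mul_sum]
  rw [Finset.sum_comm]
  exact Finset.sum_congr rfl fun i _ => Finset.sum_congr rfl fun j _ => by ring

theorem sum_fiberAverage_inner_sq (w : G.edgeSet → ℝ) (S : Finset (Fin (Fintype.card V))) :
    ∑ j, ∑ i, fiberAverage (eigenvalue G 1) S i *
      (inner ℝ (eigenBasis G w j) (eigenBasis G 1 i)) ^ 2 = S.card := by
  rw [sum_sum_mul_inner_sq]
  simpa using sum_fiberAverage_mul_comp (eigenvalue G 1) S fun _ => 1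

theorem sum_eigenvalue_le_of_isEdgeRigid (h : IsEdgeRigid G) {w : G.edgeSet → ℝ}
    (hw : w ∈ weightSimplex G) {S : Finset (Fin (Fintype.card V))}
    (hS : ∀ i ∈ S, ∀ j ∉ S, i ≤ j) :
    ∑ j ∈ S, eigenvalue G w j ≤ ∑ j ∈ S, eigenvalue G 1 j := by
  rw [sum_eigenvalue_one_eq h hw]
  exact sum_le_sum_mul_of_le
    (sum_mul_inner_sq_nonneg _ _ (fiberAverage_nonneg _ _))
    (sum_mul_inner_sq_le_one _ _ (fiberAverage_le_one _ _))
    (sum_fiberAverage_inner_sq w S)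
    fun i hi j hj => eigenvalue_monotone G w (hS i hi j hj)

theorem le_sum_eigenvalue_of_isEdgeRigid (h : IsEdgeRigid G) {w : G.edgeSet → ℝ}
    (hw : w ∈ weightSimplex G) {S : Finset (Fin (Fintype.card V))}
    (hS : ∀ i ∈ S, ∀ j ∉ S, j ≤ i) :
    ∑ j ∈ S, eigenvalue G 1 j ≤ ∑ j ∈ S, eigenvalue G w j := by
  rw [sum_eigenvalue_one_eq h hw]
  exact sum_mul_le_sum_of_le
    (sum_mul_inner_sq_nonneg _ _ (fiberAverage_nonneg _ _))
    (sum_mul_inner_sq_le_one _ _ (fiberAverage_le_one _ _))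
    (sum_fiberAverage_inner_sq w S)
    fun i hi j hj => eigenvalue_monotone G w (hS i hi j hj)

theorem sumSmallest_le_sumLargest (w : G.edgeSet → ℝ) {k : ℕ} (hk : k < Fintype.card V) :
    sumSmallest G k w ≤ sumLargest G k w := by
  unfold sumSmallest sumLargest
  have hcard : (Finset.univ.filter fun i : Fin (Fintype.card V) =>
      1 ≤ i.val ∧ i.val ≤ k).card = k := by
    have : (Finset.univ.filter fun i : Fin (Fintype.card V) => 1 ≤ i.val ∧ i.val ≤ k).map
        Fin.valEmbedding = Finset.Icc 1 k := by
      ext j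
      simp only [Finset.mem_map, Finset.mem_filter, Finset.mem_univ, true_and,
        Fin.valEmbedding_apply, Finset.mem_Icc]
      exact ⟨by rintro ⟨i, hi, rfl⟩; exact hi, fun hj => ⟨⟨j, by omega⟩, hj, rfl⟩⟩
    rw [← Finset.card_map Fin.valEmbedding, this, Nat.card_Icc, Nat.add_sub_cancel]
  have hcard' : (Finset.univ.filter fun i : Fin (Fintype.card V) =>
      Fintype.card V ≤ i.val + k).card = k := by
    have : (Finset.univ.filter fun i : Fin (Fintype.card V) => Fintype.card V ≤ i.val + k).map
        Fin.valEmbedding = Finset.Ico (Fintype.card V - k) (Fintype.card V) := by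
      ext j
      simp only [Finset.mem_map, Finset.mem_filter, Finset.mem_univ, true_and,
        Fin.valEmbedding_apply, Finset.mem_Ico]
      exact ⟨by rintro ⟨i, hi, rfl⟩; omega, fun hj => ⟨⟨j, by omega⟩, by simp; omega, rfl⟩⟩
    rw [← Finset.card_map Fin.valEmbedding, this, Nat.card_Ico]
    omega
  have := sum_mul_le_sum_of_le (a := eigenvalue G w)
    (d := fun i => if 1 ≤ i.val ∧ i.val ≤ k then 1 else 0)
    (S := Finset.univ.filter fun i : Fin (Fintype.card V) => Fintype.card V ≤ i.val + k)
    (fun i => by positivity) (fun i => by split_ifs <;> norm_num)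
    (by rw [hcard', ← Finset.sum_filter, Finset.sum_const, hcard]; simp)
    (fun i hi j hj => eigenvalue_monotone G w (by simp at hi hj; rw [Fin.le_def]; omega))
  simpa only [mul_ite, mul_one, mul_zero, ← Finset.sum_filter] using this

theorem IsEdgeRigid.isTotallyConformallyRigid (h : IsEdgeRigid G) :
    IsTotallyConformallyRigid G := by
  intro k _ hk w hw w' hw'
  refine ⟨?_, sumSmallest_le_sumLargest 1 hk, ?_⟩
  · rw [← sum_filter_lt_eigenvalue G hw.1,
      ← sum_filter_lt_eigenvalue G (one_mem_weightSimplex G).1]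
    exact sum_eigenvalue_le_of_isEdgeRigid h hw fun i hi j hj => by
      simp at hi hj; rw [Fin.le_def]; omega
  · exact le_sum_eigenvalue_of_isEdgeRigid h hw' fun i hi j hj => by
      simp at hi hj; rw [Fin.le_def]; omega

/-! ### Totally conformally rigid graphs are edge-rigid -/

/-- Evaluating `𝓛(𝟙 + t h)` on its own eigenvectors `v` leaves a surplus in the unperturbed part, by
the gap. It pays for replacing `v` by `b` in the first-order term, up to `O(t²)`. -/
theorem sum_eigenvalue_add_le (h : G.edgeSet → ℝ) (t : ℝ) {S : Finset (Fin (Fintype.card V))}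
    {τ δ : ℝ} (hδ : 0 < δ) (hS : ∀ i ∈ S, eigenvalue G 1 i ≤ τ)
    (hSc : ∀ i ∉ S, τ + δ ≤ eigenvalue G 1 i) :
    ∑ i ∈ S, eigenvalue G 1 i +
      t * ∑ i ∈ S, ∑ e, h e * edgeForm (e : Sym2 V) (eigenBasis G 1 i).ofLp ≤
    ∑ i ∈ S, eigenvalue G (1 + t • h) i +
      t ^ 2 * ((∑ x, ∑ y, weightedLaplacian G h x y ^ 2) / (2 * δ)) := by
  set v := eigenBasis G (1 + t • h) with hv
  set b := eigenBasis G 1 with hb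
  have h1 := smul_sum_dotProduct_mulVec_le b v S (weightedLaplacian G h) hδ t
  simp only [dotProduct_weightedLaplacian_mulVec] at h1
  have h2 := sum_add_gap_mul_le (a := eigenvalue G 1) (S := S)
    (d := fun i => ∑ j, (if j ∈ S then 1 else 0) * (inner ℝ (b i) (v j)) ^ 2)
    (sum_mul_inner_sq_nonneg v b fun j => by positivity)
    (sum_mul_inner_sq_le_one v b fun j => by split_ifs <;> norm_num)
    (by rw [sum_sum_mul_inner_sq]; simp) hS hSc
  have h3 : ∑ i ∈ S, eigenvalue G (1 + t • h) i =
      ∑ i, eigenvalue G 1 i * ∑ j, (if j ∈ S then 1 else 0) * (inner ℝ (b i) (v j)) ^ 2 +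
      t * ∑ j ∈ S, ∑ e, h e * edgeForm (e : Sym2 V) (v j).ofLp := by
    have : ∀ j, eigenvalue G (1 + t • h) j =
        ∑ i, eigenvalue G 1 i * (inner ℝ (b i) (v j)) ^ 2 +
          t * ∑ e, h e * edgeForm (e : Sym2 V) (v j).ofLp := fun j => by
      rw [← sum_mul_edgeForm_eigenBasis, ← sum_mul_edgeForm_eq, Finset.mul_sum,
        ← Finset.sum_add_distrib]
      refine Finset.sum_congr rfl fun e _ => ?_
      simp only [Pi.add_apply, Pi.one_apply, Pi.smul_apply, smul_eq_mul, hv]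
      ring
    simp only [this, Finset.sum_add_distrib, ← Finset.mul_sum]
    congr 1
    simp only [ite_mul, one_mul, zero_mul, Finset.sum_ite_mem, Finset.univ_inter, Finset.mul_sum]
    rw [Finset.sum_comm]
  have h4 : ∑ i ∈ S, ∑ j, (if j ∈ S then (1 : ℝ) else 0) * (inner ℝ (b i) (v j)) ^ 2 =
      ∑ j ∈ S, ∑ i ∈ S, (inner ℝ (v j) (b i)) ^ 2 := by
    simp only [ite_mul, one_mul, zero_mul, Finset.sum_ite_mem, Finset.univ_inter]
    rw [Finset.sum_comm]
    simp only [real_inner_comm]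
  rw [h4] at h2
  linarith

theorem IsTotallyConformallyRigid.sum_eigenvalue_le (hG : IsTotallyConformallyRigid G)
    {w : G.edgeSet → ℝ} (hw : w ∈ weightSimplex G) {S : Finset (Fin (Fintype.card V))}
    (hS : ∀ i ∈ S, ∀ j ≤ i, j ∈ S) :
    ∑ i ∈ S, eigenvalue G w i ≤ ∑ i ∈ S, eigenvalue G 1 i := by
  have hmem := val_lt_card_iff_mem hS
  have hle : S.card ≤ Fintype.card V := by simpa using S.card_le_univ
  -- Rigidity starts at `k = 1`, that is at `|S| = 2`; smaller sets contain at most the trivial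
  -- eigenvalue.
  by_cases hc : S.card ≤ 1
  · refine le_of_eq (Finset.sum_congr rfl fun i hi => ?_)
    have hi0 : i.val = 0 := by have := (hmem i).mpr hi; omega
    rw [eigenvalue_eq_zero_of_val_eq_zero G hw.1 hi0,
      eigenvalue_eq_zero_of_val_eq_zero G (one_mem_weightSimplex G).1 hi0]
  · obtain ⟨k, hk⟩ : ∃ k, S.card = k + 1 := ⟨S.card - 1, by omega⟩
    have hSk : S = Finset.univ.filter fun i : Fin (Fintype.card V) => i.val < k + 1 := by
      ext i
      simp [← hmem i, hk]
    rw [hSk, sum_filter_lt_eigenvalue G hw.1,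
      sum_filter_lt_eigenvalue G (one_mem_weightSimplex G).1]
    exact (hG k (by omega) (by omega) w hw w hw).1

theorem IsTotallyConformallyRigid.sum_edgeForm_le (hG : IsTotallyConformallyRigid G) (μ : ℝ)
    (e f : G.edgeSet) :
    ∑ i with eigenvalue G 1 i ≤ μ, edgeForm (e : Sym2 V) (eigenBasis G 1 i).ofLp ≤
      ∑ i with eigenvalue G 1 i ≤ μ, edgeForm (f : Sym2 V) (eigenBasis G 1 i).ofLp := by
  set S := Finset.univ.filter fun i => eigenvalue G 1 i ≤ μ with hSdef
  obtain ⟨δ, hδ, hgap⟩ := exists_gap_above (eigenvalue G 1) μ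
  -- Total weight is preserved, and `𝟙 + t h ≥ 0` as long as `0 ≤ t ≤ 1`.
  let h : G.edgeSet → ℝ := Pi.single e 1 - Pi.single f 1
  set C := (∑ x, ∑ y, weightedLaplacian G h x y ^ 2) / (2 * δ) with hC
  have hC0 : 0 ≤ C := by positivity
  have hform : ∑ i ∈ S, ∑ e', h e' * edgeForm (e' : Sym2 V) (eigenBasis G 1 i).ofLp =
      ∑ i ∈ S, edgeForm (e : Sym2 V) (eigenBasis G 1 i).ofLp -
        ∑ i ∈ S, edgeForm (f : Sym2 V) (eigenBasis G 1 i).ofLp := by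
    rw [← Finset.sum_sub_distrib]
    refine Finset.sum_congr rfl fun i _ => ?_
    simp [h, sub_mul, Finset.sum_sub_distrib, Pi.single_apply]
  have key : ∀ t : ℝ, 0 < t → t ≤ 1 →
      ∑ i ∈ S, edgeForm (e : Sym2 V) (eigenBasis G 1 i).ofLp -
        ∑ i ∈ S, edgeForm (f : Sym2 V) (eigenBasis G 1 i).ofLp ≤ t * C := fun t ht ht1 => by
    have hw : 1 + t • h ∈ weightSimplex G := by
      constructor
      · intro e'
        simp only [h, Pi.add_apply, Pi.one_apply, Pi.smul_apply, Pi.sub_apply, Pi.single_apply,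
          smul_eq_mul]
        split_ifs <;> linarith
      · simp [h, Finset.sum_add_distrib, ← Finset.mul_sum]
    have h1 := sum_eigenvalue_add_le h t (S := S) hδ (τ := μ) (fun i hi => by simpa [S] using hi)
      (fun i hi => hgap i (by simpa [S] using hi))
    have h2 := hG.sum_eigenvalue_le hw (S := S) fun i hi j hj => by
      simp only [S, Finset.mem_filter, Finset.mem_univ, true_and] at hi ⊢
      exact (eigenvalue_monotone G 1 hj).trans hi
    rw [hform] at h1
    refine le_of_mul_le_mul_left ?_ ht
    nlinarith
  by_contra! hlt
  rw [← sub_pos] at hlt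
  set a := ∑ i ∈ S, edgeForm (e : Sym2 V) (eigenBasis G 1 i).ofLp -
        ∑ i ∈ S, edgeForm (f : Sym2 V) (eigenBasis G 1 i).ofLp with ha
  -- This `t` is at most `1` and satisfies `t * C < a`, also when `C = 0`.
  have hk := key (a / (a + C + C)) (by positivity)
    ((div_le_one (by positivity)).mpr (by linarith))
  rw [div_mul_eq_mul_div, le_div_iff₀ (by positivity)] at hk
  nlinarith [mul_nonneg hlt.le hC0, mul_pos hlt hlt]

theorem IsTotallyConformallyRigid.sum_edgeForm_fiber_eq (hG : IsTotallyConformallyRigid G)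
    (μ : ℝ) (e f : G.edgeSet) :
    ∑ i with eigenvalue G 1 i = μ, edgeForm (e : Sym2 V) (eigenBasis G 1 i).ofLp =
      ∑ i with eigenvalue G 1 i = μ, edgeForm (f : Sym2 V) (eigenBasis G 1 i).ofLp := by
  -- A gap below `μ`: the eigenvalues less than `μ` are exactly those at most `μ - δ`.
  obtain ⟨δ, hδ, hgap⟩ := exists_gap_above (fun i => -eigenvalue G 1 i) (-μ)
  have hsplit : ∀ e : G.edgeSet,
      ∑ i with eigenvalue G 1 i = μ, edgeForm (e : Sym2 V) (eigenBasis G 1 i).ofLp =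
        ∑ i with eigenvalue G 1 i ≤ μ, edgeForm (e : Sym2 V) (eigenBasis G 1 i).ofLp -
        ∑ i with eigenvalue G 1 i ≤ μ - δ, edgeForm (e : Sym2 V) (eigenBasis G 1 i).ofLp := by
    intro e
    simp only [Finset.sum_filter]
    rw [← Finset.sum_sub_distrib]
    refine Finset.sum_congr rfl fun i _ => ?_
    rcases lt_trichotomy (eigenvalue G 1 i) μ with hlt | heq | hgt
    · have := hgap i (neg_lt_neg hlt)
      rw [if_neg hlt.ne, if_pos hlt.le, if_pos (by linarith), sub_self]
    · rw [if_pos heq, if_pos heq.le, if_neg (by linarith), sub_zero]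
    · rw [if_neg hgt.ne', if_neg (by linarith), if_neg (by linarith), sub_self]
  rw [hsplit, hsplit, (hG.sum_edgeForm_le μ e f).antisymm (hG.sum_edgeForm_le μ f e),
    (hG.sum_edgeForm_le (μ - δ) e f).antisymm (hG.sum_edgeForm_le (μ - δ) f e)]

theorem IsTotallyConformallyRigid.isEdgeRigid (hG : IsTotallyConformallyRigid G) :
    IsEdgeRigid G := by
  intro μ hμ hμ0
  obtain ⟨i₀, hi₀⟩ := exists_eigenvalue_eq G hμ
  have hμpos : 0 < μ := lt_of_le_of_ne
    (hi₀ ▸ eigenvalue_nonneg G (one_mem_weightSimplex G).1 i₀) (Ne.symm hμ0)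
  -- The total over all edges is `μ` times its multiplicity, so some edge has a positive value, and
  -- that value serves as `γ`.
  have htotal : 0 < ∑ e : G.edgeSet,
      ∑ i with eigenvalue G 1 i = μ, edgeForm (e : Sym2 V) (eigenBasis G 1 i).ofLp := by
    rw [Finset.sum_comm]
    refine Finset.sum_pos (fun i hi => ?_) ⟨i₀, by simpa using hi₀⟩
    have hs := sum_mul_edgeForm_eigenBasis G 1 i
    simp only [Pi.one_apply, one_mul] at hs
    rw [hs, (Finset.mem_filter.mp hi).2]
    exact hμpos
  obtain ⟨e₀, -, he₀⟩ := Finset.exists_lt_of_sum_lt (f := fun _ => (0 : ℝ)) (by simpa using htotal)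
  refine ⟨_, he₀, fun e => ?_⟩
  rw [laplacianAdjoint_eigenprojector]
  exact hG.sum_edgeForm_fiber_eq μ e e₀

end Spectral

end

end ConformalRigidity

theorem mainTheorem1 {V : Type*} [Fintype V] [DecidableEq V] (G : SimpleGraph V)
    [DecidableRel G.Adj] (hG : G.Connected) :
    ConformalRigidity.IsTotallyConformallyRigid G ↔ ConformalRigidity.IsEdgeRigid G :=
  ⟨fun h => h.isEdgeRigid, fun h => h.isTotallyConformallyRigid⟩
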